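/- Let $d\ge 1$. A face of a polytope is the empty set, the polytope itself, or the set of maximizers over it of a linear functional. A $d$-dimensional lattice polytope $P\subset\mathbb{R}^d$ is \emph{smooth} if every vertex of $P$ lies on exactly $d$ edges and the primitive edge directions at every vertex form a basis of $\mathbb{Z}^d$. A $d$-dimensional \emph{prism} is a polytope affinely equivalent to $Q\times[0,1]$ for some $(d-1)$-dimensional polytope $Q$, with bottom and top corresponding to $Q\times\{0\}$ and $Q\times\{1\}$. A $d$-dimensional \emph{prismatoid} with bottom $B$ and top $T$ is a $d$-dimensional polytope $P$ with an isomorphism from the face lattice of a prism to the face lattice of $P$ that takes the bottom and top of the prism to $B$ and $T$, where $B$ and $T$ are parallel. Two polytopes in $\mathbb{R}^d$ are \emph{Minkowski equivalent} if they have the same normal fan, the collection of the normal cones (in $\mathbb{R}^d$) of their nonempty faces. \textbf{Lemma.} Let $P\subset\mathbb{R}^d$ be a $d$-dimensional smooth prismatoid with bottom $B\subset\{x: x_d=b\}$ and top $T\subset\{x: x_d=b+h\}$, where $b$ and $h\ge 0$ are integers. Then for every $l\in\{0,1,\dots,h\}$ the slice $$S_l = P\cap\{x\in\mathbb{R}^d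 : x_d=b+l\}$$ is a (nonempty) lattice polytope of dimension $d-1$, and it is Minkowski equivalent to $B$ and to $T$. -/

import Mathlib

namespace SmoothPrismatoid

/-- A set in real `d`-space is a (nonempty) polytope if it is the convex hull of a nonempty finite
set. -/
def IsPolytope {d : ℕ} (P : Set (Fin d → ℝ)) : Prop :=
  ∃ s : Finset (Fin d → ℝ), s.Nonempty ∧ P = convexHull ℝ (s : Set (Fin d → ℝ))

/-- The real vector with the given integer coordinates. -/
def latticePoint {d : ℕ} (z : Fin d → ℤ) : Fin d → ℝ := fun i => (z i : ℝ)

/-- A lattice (integer) polytope: the convex hull of a nonempty finite set of lattice points. -/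
def IsLatticePolytope {d : ℕ} (P : Set (Fin d → ℝ)) : Prop :=
  ∃ s : Finset (Fin d → ℤ), s.Nonempty ∧
    P = convexHull ℝ (latticePoint '' (s : Set (Fin d → ℤ)))

/-- `P` is nonempty and its affine hull has dimension `k`. -/
def HasDim {d : ℕ} (P : Set (Fin d → ℝ)) (k : ℕ) : Prop :=
  P.Nonempty ∧ Module.finrank ℝ (vectorSpan ℝ P) = k

/-- The faces of `P`: the empty set, and the sets of maximizers over `P` of a linear functional
(`P` itself is obtained from the zero functional). -/
def IsFace {d : ℕ} (P F : Set (Fin d → ℝ)) : Prop := IsExposed ℝ P F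

/-- The face poset of `P`, ordered by inclusion. -/
abbrev FacePoset {d : ℕ} (P : Set (Fin d → ℝ)) : Type :=
  {F : Set (Fin d → ℝ) // IsFace P F}

/-- `v` is a vertex of `P`. -/
def IsVertex {d : ℕ} (P : Set (Fin d → ℝ)) (v : Fin d → ℝ) : Prop := IsFace P {v}

/-- An edge of `P` is a one-dimensional face. -/
def IsEdge {d : ℕ} (P F : Set (Fin d → ℝ)) : Prop := IsFace P F ∧ HasDim F 1

/-- Two sets are parallel if their affine hulls are translates of the same linear subspace. -/
def AreParallel {d : ℕ} (F G : Set (Fin d → ℝ)) : Prop := vectorSpan ℝ F = vectorSpan ℝ G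

/-- An integer vector is primitive if it is not a multiple of another one by a non-unit
(so that in particular it is nonzero). -/
def IsPrimitiveVector {d : ℕ} (u : Fin d → ℤ) : Prop :=
  ∀ (k : ℤ) (w : Fin d → ℤ), u = k • w → IsUnit k

/-- The primitive edge directions at `v`: the primitive integer vectors which point from `v` along
some edge of `P` that contains `v`. -/
def primitiveEdgeDirections {d : ℕ} (P : Set (Fin d → ℝ)) (v : Fin d → ℝ) : Set (Fin d → ℤ) :=
  {u | IsPrimitiveVector u ∧
    ∃ F, IsEdge P F ∧ v ∈ F ∧ ∃ t : ℝ, 0 < t ∧ v + t • latticePoint u ∈ F}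

/-- A set of integer vectors is a basis of the integer lattice. -/
def IsLatticeBasis {d : ℕ} (D : Set (Fin d → ℤ)) : Prop :=
  LinearIndependent ℤ (fun u : D => (u : Fin d → ℤ)) ∧ Submodule.span ℤ D = ⊤

/-- A full-dimensional polytope in real `d`-space is simple if every vertex lies on exactly `d`
edges. -/
def IsSimplePolytope {d : ℕ} (P : Set (Fin d → ℝ)) : Prop :=
  IsPolytope P ∧ HasDim P d ∧ ∀ v, IsVertex P v → {F | IsEdge P F ∧ v ∈ F}.ncard = d

/-- A smooth polytope in real `d`-space: a simple `d`-dimensional lattice polytope such that the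
primitive edge directions at every vertex form a basis of the integer lattice. -/
def IsSmoothPolytope {d : ℕ} (P : Set (Fin d → ℝ)) : Prop :=
  IsLatticePolytope P ∧ IsSimplePolytope P ∧
    ∀ v, IsVertex P v → IsLatticeBasis (primitiveEdgeDirections P v)

/-- `R` is an `(n + 1)`-dimensional prism with bottom `B` and top `T`: an affine image of
`Q × [0, 1]`, with `B` and `T` the images of `Q × {0}` and `Q × {1}`, for an `n`-dimensional
polytope `Q`. -/
def IsPrism {n : ℕ} (R B T : Set (Fin (n + 1) → ℝ)) : Prop :=
  ∃ (Q : Set (Fin n → ℝ)) (f : ((Fin n → ℝ) × ℝ) ≃ᵃ[ℝ] (Fin (n + 1) → ℝ)),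
    IsPolytope Q ∧ HasDim Q n ∧
    R = f '' (Q ×ˢ Set.Icc (0 : ℝ) 1) ∧ B = f '' (Q ×ˢ {(0 : ℝ)}) ∧ T = f '' (Q ×ˢ {(1 : ℝ)})

/-- `P` is an `(n + 1)`-dimensional prismatoid with bottom `B` and top `T`: a polytope with an
isomorphism from the face poset of a prism to that of `P` which takes the bottom and the top of the
prism to `B` and `T`, and these are parallel. -/
def IsPrismatoid {n : ℕ} (P B T : Set (Fin (n + 1) → ℝ)) : Prop :=
  IsPolytope P ∧ HasDim P (n + 1) ∧ AreParallel B T ∧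
    ∃ (R B' T' : Set (Fin (n + 1) → ℝ)), IsPrism R B' T' ∧
      ∃ e : FacePoset R ≃o FacePoset P, ∃ FB FT : FacePoset R,
        (FB : Set (Fin (n + 1) → ℝ)) = B' ∧ (FT : Set (Fin (n + 1) → ℝ)) = T' ∧
        (e FB : Set (Fin (n + 1) → ℝ)) = B ∧ (e FT : Set (Fin (n + 1) → ℝ)) = T

/-- The (outer) normal cone of a face `F` of `P`: the directions which are maximized over `P` at
every point of `F`. -/
def normalCone {d : ℕ} (P F : Set (Fin d → ℝ)) : Set (Fin d → ℝ) :=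
  {u | ∀ x ∈ F, ∀ y ∈ P, u ⬝ᵥ y ≤ u ⬝ᵥ x}

/-- The normal fan of `P`: the collection of the normal cones of its nonempty faces. -/
def normalFan {d : ℕ} (P : Set (Fin d → ℝ)) : Set (Set (Fin d → ℝ)) :=
  {C | ∃ F, IsFace P F ∧ F.Nonempty ∧ C = normalCone P F}

/-- Minkowski equivalence: equality of the normal fans. -/
def MinkowskiEquivalent {d : ℕ} (P Q : Set (Fin d → ℝ)) : Prop := normalFan P = normalFan Q

/-- The intersection of `P` with the hyperplane where the last coordinate equals `c`. -/
def sliceAt {n : ℕ} (P : Set (Fin (n + 1) → ℝ)) (c : ℤ) : Set (Fin (n + 1) → ℝ) :=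
  P ∩ {x | x (Fin.last n) = (c : ℝ)}

end SmoothPrismatoid

/-! Two properties of the ends of a prism are visible in its face poset: every nonempty face meets
an end, and for faces `A`, `A'` meeting both ends, `A ∩ B ⊆ A'` iff `A ∩ T ⊆ A'`. The poset
isomorphism carries them to `P` (`IsPrismatoid.areEnds`). The first puts all vertices in `B ∪ T`, so
`P` is the union of the segments from `B` to `T`, and its slice at relative height `μ` is `(1 - μ) •
B + μ • T`.

Any functional can be tilted along the last coordinate until its maxima over `B` and `T` agree. The
face of `P` it selects then meets both ends exactly in their own maximizers, so the second property
gives `argmax B u ⊆ argmax B w` iff `argmax T u ⊆ argmax T w`. This relation determines the normal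
fan, and it passes to Minkowski combinations.

For integrality, a vertex of an intermediate slice is `(1 - l/h) • v + (l/h) • w`, where one
functional selects the vertices `v` of `B` and `w` of `T`. Every edge at `v` leaving the level of
`B` contains `w`. By smoothness, exactly one primitive direction at `v` has nonzero last coordinate,
and that coordinate is `±1`. Hence `w - v` is `h` times a lattice vector `z`, and the vertex is `v +
l • z`. -/

namespace SmoothPrismatoid

/-! ### Maximizer sets and the normal fan -/

/-- The points of `A` at which the functional `u ⬝ᵥ ·` attains its maximum over `A`. -/
def argmax {d : ℕ} (A : Set (Fin d → ℝ)) (u : Fin d → ℝ) : Set (Fin d → ℝ) :=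
  {x ∈ A | ∀ y ∈ A, u ⬝ᵥ y ≤ u ⬝ᵥ x}

theorem exists_dotProduct_eq {d : ℕ} (l : StrongDual ℝ (Fin d → ℝ)) :
    ∃ u : Fin d → ℝ, ∀ x, l x = u ⬝ᵥ x := by
  refine ⟨(dotProductEquiv ℝ (Fin d)).symm l.toLinearMap, fun x => ?_⟩
  have := (dotProductEquiv ℝ (Fin d)).apply_symm_apply l.toLinearMap
  exact (LinearMap.congr_fun this x).symm

theorem isFace_argmax {d : ℕ} (A : Set (Fin d → ℝ)) (u : Fin d → ℝ) : IsFace A (argmax A u) :=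
  fun _ => ⟨LinearMap.toContinuousLinearMap (dotProductEquiv ℝ (Fin d) u), rfl⟩

theorem IsFace.exists_eq_argmax {d : ℕ} {A F : Set (Fin d → ℝ)} (hF : IsFace A F)
    (hne : F.Nonempty) : ∃ u, F = argmax A u := by
  obtain ⟨l, hl⟩ := hF hne
  obtain ⟨u, hu⟩ := exists_dotProduct_eq l
  refine ⟨u, ?_⟩
  rw [hl]
  simp only [hu]
  rfl

theorem argmax_nonempty {d : ℕ} {A : Set (Fin d → ℝ)} (hA : IsCompact A) (hne : A.Nonempty)
    (u : Fin d → ℝ) : (argmax A u).Nonempty := by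
  have hc : Continuous fun x : Fin d → ℝ => u ⬝ᵥ x := by fun_prop
  obtain ⟨x, hx, hm⟩ := hA.exists_isMaxOn hne hc.continuousOn
  exact ⟨x, hx, fun y hy => hm hy⟩

theorem normalCone_eq {d : ℕ} {A F : Set (Fin d → ℝ)} (hF : F ⊆ A) :
    normalCone A F = {w | F ⊆ argmax A w} := by
  ext w
  exact ⟨fun h x hx => ⟨hF hx, h x hx⟩, fun h x hx => (h hx).2⟩

/-- The normal cone of `argmax A u` is the set of `w` with `argmax A u ⊆ argmax A w`, so the fan
depends only on this relation between functionals. -/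
theorem normalFan_subset {d : ℕ} {A A' : Set (Fin d → ℝ)} (hA' : ∀ u, (argmax A' u).Nonempty)
    (h : ∀ u w, argmax A u ⊆ argmax A w ↔ argmax A' u ⊆ argmax A' w) :
    normalFan A ⊆ normalFan A' := by
  rintro C ⟨F, hF, hne, rfl⟩
  obtain ⟨u, rfl⟩ := hF.exists_eq_argmax hne
  refine ⟨argmax A' u, isFace_argmax A' u, hA' u, ?_⟩
  rw [normalCone_eq fun _ hx => hx.1, normalCone_eq fun _ hx => hx.1]
  ext w
  exact h u w

theorem minkowskiEquivalent_of_argmax {d : ℕ} {A A' : Set (Fin d → ℝ)}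
    (hA : ∀ u, (argmax A u).Nonempty) (hA' : ∀ u, (argmax A' u).Nonempty)
    (h : ∀ u w, argmax A u ⊆ argmax A w ↔ argmax A' u ⊆ argmax A' w) :
    MinkowskiEquivalent A A' :=
  (normalFan_subset hA' h).antisymm (normalFan_subset hA fun u w => (h u w).symm)

/-! ### Vertices of polytopes -/

theorem IsVertex.mem {d : ℕ} {A : Set (Fin d → ℝ)} {v : Fin d → ℝ} (hv : IsVertex A v) : v ∈ A :=
  IsExposed.subset hv rfl

theorem IsVertex.mem_of_convexHull {d : ℕ} {s : Set (Fin d → ℝ)} {v : Fin d → ℝ}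
    (hv : IsVertex (convexHull ℝ s) v) : v ∈ s :=
  extremePoints_convexHull_subset (isExtreme_singleton.1 (IsExposed.isExtreme hv))

/-- An extreme point is outside the hull of the other generators, so a functional separates it
strictly from them, and this functional exposes it. -/
theorem isVertex_of_mem_extremePoints {d : ℕ} {s : Set (Fin d → ℝ)} (hs : s.Finite)
    {v : Fin d → ℝ} (hv : v ∈ (convexHull ℝ s).extremePoints ℝ) :
    IsVertex (convexHull ℝ s) v := by
  have hvs : v ∈ s := extremePoints_convexHull_subset hv
  have hsub : s \ {v} ⊆ convexHull ℝ s \ {v} := fun x hx =>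
    ⟨subset_convexHull ℝ s hx.1, hx.2⟩
  have hconv : Convex ℝ (convexHull ℝ s \ {v}) :=
    ((convex_convexHull ℝ s).mem_extremePoints_iff_convex_sdiff.1 hv).2
  have hnot : v ∉ convexHull ℝ (s \ {v}) := fun h => (convexHull_min hsub hconv h).2 rfl
  obtain ⟨f, c, hf, hc⟩ := geometric_hahn_banach_closed_point (convex_convexHull ℝ (s \ {v}))
    ((hs.subset Set.sdiff_subset).isCompact_convexHull ℝ).isClosed hnot
  have hlt : ∀ x ∈ s, x ≠ v → f x < f v := fun x hx hxv =>
    (hf x (subset_convexHull ℝ _ ⟨hx, hxv⟩)).trans hc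
  -- The open half-space together with the single boundary point `v` is still convex, so it contains
  -- the whole hull once it contains `s`.
  have hC : Convex ℝ {x | f x < f v ∨ x = v} := by
    intro x hx y hy a b ha hb hab
    by_cases hxv : x = v
    · by_cases hyv : y = v
      · right
        rw [hxv, hyv, ← add_smul, hab, one_smul]
      · rcases hb.eq_or_lt with rfl | hb
        · right
          rw [add_zero] at hab
          simp [hab, hxv]
        · left
          have hy' := hy.resolve_right hyv
          simp only [map_add, map_smul, smul_eq_mul, hxv]
          nlinarith [mul_pos hb (sub_pos.2 hy'), congrArg (· * f v) hab]
    · have hx' := hx.resolve_right hxv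
      have hy' : f y ≤ f v := hy.elim le_of_lt fun h => h ▸ le_rfl
      rcases ha.eq_or_lt with rfl | ha
      · rw [zero_add] at hab
        simpa [hab] using hy
      · left
        simp only [map_add, map_smul, smul_eq_mul]
        nlinarith [mul_pos ha (sub_pos.2 hx'), mul_nonneg hb (sub_nonneg.2 hy'),
          congrArg (· * f v) hab]
  have hall : ∀ x ∈ convexHull ℝ s, f x < f v ∨ x = v := fun x hx =>
    convexHull_min (fun y hy => (em (y = v)).elim Or.inr fun h => Or.inl (hlt y hy h)) hC hx
  refine fun _ => ⟨f, ?_⟩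
  ext x
  constructor
  · rintro rfl
    exact ⟨hv.1, fun y hy => (hall y hy).elim le_of_lt fun h => h ▸ le_rfl⟩
  · rintro ⟨hx, hm⟩
    exact (hall x hx).resolve_left (not_lt.2 (hm v hv.1))

theorem convexHull_vertices {d : ℕ} {s : Set (Fin d → ℝ)} (hs : s.Finite) :
    convexHull ℝ {v | IsVertex (convexHull ℝ s) v} = convexHull ℝ s := by
  apply (convexHull_min (fun v hv => IsVertex.mem hv) (convex_convexHull ℝ s)).antisymm
  have hfin : ((convexHull ℝ s).extremePoints ℝ).Finite :=
    hs.subset extremePoints_convexHull_subset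
  conv_lhs => rw [← closure_convexHull_extremePoints (hs.isCompact_convexHull ℝ)
    (convex_convexHull ℝ s), (hfin.isCompact_convexHull ℝ).isClosed.closure_eq]
  exact convexHull_mono fun v hv => isVertex_of_mem_extremePoints hs hv

theorem IsLatticePolytope.of_vertices {d : ℕ} {s : Set (Fin d → ℝ)} (hs : s.Finite)
    (hne : s.Nonempty)
    (h : ∀ v, IsVertex (convexHull ℝ s) v → v ∈ Set.range (latticePoint (d := d))) :
    IsLatticePolytope (convexHull ℝ s) := by
  have hinj : Function.Injective (latticePoint (d := d)) := fun a b hab => by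
    funext i
    exact Int.cast_injective (α := ℝ) (congrFun hab i)
  have hfin : (latticePoint ⁻¹' {v | IsVertex (convexHull ℝ s) v}).Finite :=
    (hs.subset fun v hv => IsVertex.mem_of_convexHull hv).preimage hinj.injOn
  have himg : latticePoint '' (latticePoint ⁻¹' {v | IsVertex (convexHull ℝ s) v}) =
      {v | IsVertex (convexHull ℝ s) v} := Set.image_preimage_eq_of_subset h
  refine ⟨hfin.toFinset, ?_, ?_⟩
  · have : (convexHull ℝ {v | IsVertex (convexHull ℝ s) v}).Nonempty := by
      rw [convexHull_vertices hs]
      exact hne.convexHull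
    rw [convexHull_nonempty_iff, ← himg] at this
    simpa using this
  · rw [Set.Finite.coe_toFinset, himg, convexHull_vertices hs]

/-! ### The ends of a prism and their transfer along poset isomorphisms -/

theorem prism_apply_sub {n : ℕ} (f : ((Fin n → ℝ) × ℝ) ≃ᵃ[ℝ] (Fin (n + 1) → ℝ))
    (g : StrongDual ℝ (Fin (n + 1) → ℝ)) (q : Fin n → ℝ) :
    g (f (q, 1)) - g (f (q, 0)) = g (f.linear (0, 1)) := by
  have h := f.toAffineMap.linearMap_vsub (q, 1) (q, 0)
  simp only [vsub_eq_sub, Prod.mk_sub_mk, sub_self, sub_zero] at h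
  rw [← map_sub]
  exact congrArg g h.symm

/-- A functional is affine along the vertical segment through a maximizer, so one endpoint of that
segment is a maximizer too. -/
theorem prism_face_meets {n : ℕ} {Q : Set (Fin n → ℝ)}
    {f : ((Fin n → ℝ) × ℝ) ≃ᵃ[ℝ] (Fin (n + 1) → ℝ)} {A : Set (Fin (n + 1) → ℝ)}
    (hA : IsFace (f '' (Q ×ˢ Set.Icc (0 : ℝ) 1)) A) (hne : A.Nonempty) :
    (A ∩ f '' (Q ×ˢ {(0 : ℝ)})).Nonempty ∨ (A ∩ f '' (Q ×ˢ {(1 : ℝ)})).Nonempty := by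
  obtain ⟨g, hg⟩ := hA hne
  obtain ⟨x, hx⟩ := hne
  have hx' := hx
  rw [hg] at hx'
  obtain ⟨⟨⟨q, t⟩, ⟨hq, ht⟩, rfl⟩, hm⟩ := hx'
  simp only at hq ht
  have hlin : f (q, t) = (1 - t) • f (q, 0) + t • f (q, 1) := by
    have h := AffineMap.lineMap_apply_module (k := ℝ) (f (q, 0)) (f (q, 1)) t
    have h2 := f.toAffineMap.apply_lineMap (q, 0) (q, 1) t
    have h3 : AffineMap.lineMap (q, (0 : ℝ)) (q, (1 : ℝ)) t = (q, t) := by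
      rw [AffineMap.lineMap_apply_module]
      ext <;> simp
      ring
    rw [h3] at h2
    exact h2.trans h
  have hval : g (f (q, t)) = (1 - t) * g (f (q, 0)) + t * g (f (q, 1)) := by
    rw [hlin]; simp
  have m0 : f (q, 0) ∈ f '' (Q ×ˢ Set.Icc (0 : ℝ) 1) := ⟨(q, 0), ⟨hq, by simp⟩, rfl⟩
  have m1 : f (q, 1) ∈ f '' (Q ×ˢ Set.Icc (0 : ℝ) 1) := ⟨(q, 1), ⟨hq, by simp⟩, rfl⟩
  rcases le_total (g (f (q, 1))) (g (f (q, 0))) with hle | hle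
  · refine Or.inl ⟨f (q, 0), ?_, (q, 0), ⟨hq, rfl⟩, rfl⟩
    rw [hg]
    refine ⟨m0, fun y hy => (hm y hy).trans ?_⟩
    nlinarith [mul_nonneg ht.1 (sub_nonneg.2 hle)]
  · refine Or.inr ⟨f (q, 1), ?_, (q, 1), ⟨hq, rfl⟩, rfl⟩
    rw [hg]
    refine ⟨m1, fun y hy => (hm y hy).trans ?_⟩
    nlinarith [mul_nonneg (sub_nonneg.2 ht.2) (sub_nonneg.2 hle)]

/-- The increment of a functional along vertical segments is the same for all `q`. Maximizers at the
bottom force it to be nonpositive, those at the top nonnegative, so it vanishes. -/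
theorem prism_face_mem_iff {n : ℕ} {Q : Set (Fin n → ℝ)}
    {f : ((Fin n → ℝ) × ℝ) ≃ᵃ[ℝ] (Fin (n + 1) → ℝ)} {A : Set (Fin (n + 1) → ℝ)}
    (hA : IsFace (f '' (Q ×ˢ Set.Icc (0 : ℝ) 1)) A)
    (h0 : (A ∩ f '' (Q ×ˢ {(0 : ℝ)})).Nonempty) (h1 : (A ∩ f '' (Q ×ˢ {(1 : ℝ)})).Nonempty)
    {q : Fin n → ℝ} (hq : q ∈ Q) : f (q, 0) ∈ A ↔ f (q, 1) ∈ A := by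
  obtain ⟨g, hg⟩ := hA (h0.mono Set.inter_subset_left)
  have m0 : ∀ q ∈ Q, f (q, 0) ∈ f '' (Q ×ˢ Set.Icc (0 : ℝ) 1) :=
    fun q hq => ⟨(q, 0), ⟨hq, by simp⟩, rfl⟩
  have m1 : ∀ q ∈ Q, f (q, 1) ∈ f '' (Q ×ˢ Set.Icc (0 : ℝ) 1) :=
    fun q hq => ⟨(q, 1), ⟨hq, by simp⟩, rfl⟩
  rw [hg] at h0 h1
  obtain ⟨_, ⟨-, hm0⟩, ⟨q0, t0⟩, ⟨hq0, ht0⟩, rfl⟩ := h0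
  obtain ⟨_, ⟨-, hm1⟩, ⟨q1, t1⟩, ⟨hq1, ht1⟩, rfl⟩ := h1
  simp only [Set.mem_singleton_iff] at ht0 ht1 hq0 hq1
  subst ht0 ht1
  have e0 := hm0 _ (m1 q0 hq0)
  have e1 := hm1 _ (m0 q1 hq1)
  have d0 := prism_apply_sub f g q0
  have d1 := prism_apply_sub f g q1
  have d := prism_apply_sub f g q
  have heq : g (f (q, 0)) = g (f (q, 1)) := by linarith
  rw [hg]
  constructor
  · exact fun h => ⟨m1 q hq, fun y hy => heq ▸ h.2 y hy⟩
  · exact fun h => ⟨m0 q hq, fun y hy => heq ▸ h.2 y hy⟩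

/-- The combinatorial properties that the two ends `B` and `T` of a prism have among its faces. -/
structure AreEnds {d : ℕ} (P B T : Set (Fin d → ℝ)) : Prop where
  isFace_left : IsFace P B
  isFace_right : IsFace P T
  meets : ∀ A, IsFace P A → A.Nonempty → (A ∩ B).Nonempty ∨ (A ∩ T).Nonempty
  subset_iff : ∀ A A', IsFace P A → IsFace P A' → (A ∩ B).Nonempty → (A ∩ T).Nonempty →
    (A' ∩ B).Nonempty → (A' ∩ T).Nonempty → (A ∩ B ⊆ A' ↔ A ∩ T ⊆ A')

theorem AreEnds.of_prism {n : ℕ} {R B T : Set (Fin (n + 1) → ℝ)} (h : IsPrism R B T)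
    (hB : IsFace R B) (hT : IsFace R T) : AreEnds R B T := by
  obtain ⟨Q, f, -, -, rfl, rfl, rfl⟩ := h
  refine ⟨hB, hT, fun A hA hne => prism_face_meets hA hne,
    fun A A' hA hA' h0 h1 h0' h1' => ⟨?_, ?_⟩⟩
  · rintro h _ ⟨hx, ⟨q, t⟩, ⟨hq, rfl⟩, rfl⟩
    exact (prism_face_mem_iff hA' h0' h1' hq).1
      (h ⟨(prism_face_mem_iff hA h0 h1 hq).2 hx, (q, 0), ⟨hq, rfl⟩, rfl⟩)
  · rintro h _ ⟨hx, ⟨q, t⟩, ⟨hq, rfl⟩, rfl⟩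
    exact (prism_face_mem_iff hA' h0' h1' hq).2
      (h ⟨(prism_face_mem_iff hA h0 h1 hq).1 hx, (q, 1), ⟨hq, rfl⟩, rfl⟩)

/-- The empty face is the least element of the poset, so nonemptiness means not being minimal. -/
theorem orderIso_nonempty_iff {d d' : ℕ} {R : Set (Fin d → ℝ)} {P : Set (Fin d' → ℝ)}
    (e : FacePoset R ≃o FacePoset P) (A : FacePoset R) :
    (A : Set (Fin d → ℝ)).Nonempty ↔ (e A : Set (Fin d' → ℝ)).Nonempty := by
  have key : ∀ {k : ℕ} {S : Set (Fin k → ℝ)} (A : FacePoset S),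
      (A : Set (Fin k → ℝ)).Nonempty ↔ ¬ IsMin A := by
    intro k S A
    rw [Set.nonempty_iff_ne_empty, not_iff_not]
    constructor
    · intro h C _
      change (A : Set (Fin k → ℝ)) ⊆ C
      rw [h]
      exact Set.empty_subset _
    · intro h
      have : A ≤ ⟨∅, isExposed_empty⟩ := h (Set.empty_subset (A : Set (Fin k → ℝ)))
      exact Set.subset_empty_iff.1 this
  rw [key, key, e.isMin_apply]

/-- Faces are closed under intersection, so the intersection is the greatest lower bound in the face
poset. -/
theorem orderIso_coe_inter {d d' : ℕ} {R : Set (Fin d → ℝ)} {P : Set (Fin d' → ℝ)}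
    (e : FacePoset R ≃o FacePoset P) (A C : FacePoset R) :
    (e ⟨A ∩ C, A.2.inter C.2⟩ : Set (Fin d' → ℝ)) = (e A : Set (Fin d' → ℝ)) ∩ e C := by
  apply Set.Subset.antisymm
  · exact Set.subset_inter (e.monotone (show (⟨A ∩ C, _⟩ : FacePoset R) ≤ A from
      Set.inter_subset_left)) (e.monotone (show (⟨A ∩ C, _⟩ : FacePoset R) ≤ C from
      Set.inter_subset_right))
  · change (⟨(e A : Set (Fin d' → ℝ)) ∩ e C, (e A).2.inter (e C).2⟩ : FacePoset P) ≤ e _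
    rw [← e.symm_apply_le]
    refine Set.subset_inter (e.symm_apply_le.2 ?_) (e.symm_apply_le.2 ?_)
    · exact Set.inter_subset_left (s := (e A : Set (Fin d' → ℝ)))
    · exact Set.inter_subset_right (s := (e A : Set (Fin d' → ℝ)))

theorem AreEnds.of_orderIso {d d' : ℕ} {R : Set (Fin d → ℝ)} {P : Set (Fin d' → ℝ)}
    (e : FacePoset R ≃o FacePoset P) {B T : FacePoset R} (h : AreEnds R B.1 T.1) :
    AreEnds P (e B).1 (e T).1 := by
  have hne : ∀ A C : FacePoset R, (A.1 ∩ C.1).Nonempty ↔ ((e A).1 ∩ (e C).1).Nonempty := by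
    intro A C
    rw [← orderIso_coe_inter]
    exact orderIso_nonempty_iff e ⟨A.1 ∩ C.1, _⟩
  have hsub : ∀ A C A' : FacePoset R, A.1 ∩ C.1 ⊆ A'.1 ↔ (e A).1 ∩ (e C).1 ⊆ (e A').1 := by
    intro A C A'
    rw [← orderIso_coe_inter]
    exact (e.le_iff_le (x := ⟨A.1 ∩ C.1, A.2.inter C.2⟩) (y := A')).symm
  refine ⟨(e B).2, (e T).2, fun A hA hA0 => ?_, fun A A' hA hA' => ?_⟩
  · obtain ⟨A, rfl⟩ : ∃ C, (e C).1 = A := ⟨e.symm ⟨A, hA⟩, by rw [e.apply_symm_apply]⟩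
    rw [← hne, ← hne]
    exact h.meets A.1 A.2 ((orderIso_nonempty_iff e A).2 hA0)
  · obtain ⟨A, rfl⟩ : ∃ C, (e C).1 = A := ⟨e.symm ⟨A, hA⟩, by rw [e.apply_symm_apply]⟩
    obtain ⟨A', rfl⟩ : ∃ C, (e C).1 = A' := ⟨e.symm ⟨A', hA'⟩, by rw [e.apply_symm_apply]⟩
    rw [← hne, ← hne, ← hne, ← hne, ← hsub, ← hsub]
    exact h.subset_iff A.1 A'.1 A.2 A'.2

theorem IsPrismatoid.areEnds {n : ℕ} {P B T : Set (Fin (n + 1) → ℝ)} (h : IsPrismatoid P B T) :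
    AreEnds P B T := by
  obtain ⟨-, -, -, R, _, _, hR, e, FB, FT, rfl, rfl, rfl, rfl⟩ := h
  exact (AreEnds.of_prism hR FB.2 FT.2).of_orderIso e

/-! ### Dimension, levels and the decomposition into segments -/

theorem HasDim.vectorSpan_eq_top {d : ℕ} {P : Set (Fin d → ℝ)} (hP : HasDim P d) :
    vectorSpan ℝ P = ⊤ :=
  Submodule.eq_top_of_finrank_eq (by rw [hP.2, Module.finrank_fin_fun])

theorem vectorSpan_le_ker_proj {d : ℕ} {A : Set (Fin d → ℝ)} {i : Fin d} {b : ℝ}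
    (h : ∀ x ∈ A, x i = b) :
    vectorSpan ℝ A ≤ LinearMap.ker (LinearMap.proj (R := ℝ) (φ := fun _ : Fin d => ℝ) i) := by
  refine Submodule.span_le.2 ?_
  rintro _ ⟨x, hx, y, hy, rfl⟩
  simp [h x hx, h y hy]

theorem ker_proj_lt_top {d : ℕ} (i : Fin d) :
    LinearMap.ker (LinearMap.proj (R := ℝ) (φ := fun _ : Fin d => ℝ) i) < ⊤ := by
  refine lt_top_iff_ne_top.2 fun h => ?_
  have : (Pi.single i 1 : Fin d → ℝ) ∈
      LinearMap.ker (LinearMap.proj (R := ℝ) (φ := fun _ : Fin d => ℝ) i) := h ▸ trivial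
  simp at this

theorem HasDim.not_level {d : ℕ} {P : Set (Fin d → ℝ)} (hP : HasDim P d) {i : Fin d} {b : ℝ}
    (h : ∀ x ∈ P, x i = b) : False :=
  (ker_proj_lt_top i).not_ge (hP.vectorSpan_eq_top ▸ vectorSpan_le_ker_proj h)

/-- `P` consists of the segments from the polytope `B` to the polytope `T`, which lie in two
different levels of the last coordinate. -/
structure IsLayered {n : ℕ} (P B T : Set (Fin (n + 1) → ℝ)) (b c : ℝ) : Prop where
  left : IsPolytope B
  right : IsPolytope T
  level_left : ∀ x ∈ B, x (Fin.last n) = b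
  level_right : ∀ x ∈ T, x (Fin.last n) = c
  ne : b ≠ c
  mem_iff : ∀ x, x ∈ P ↔ ∃ y ∈ B, ∃ z ∈ T, ∃ μ ∈ Set.Icc (0 : ℝ) 1, x = (1 - μ) • y + μ • z

theorem IsPolytope.of_finite {d : ℕ} {s : Set (Fin d → ℝ)} (hs : s.Finite) (hne : s.Nonempty) :
    IsPolytope (convexHull ℝ s) :=
  ⟨hs.toFinset, by simpa using hne, by simp⟩

theorem AreEnds.isLayered {n : ℕ} {P B T : Set (Fin (n + 1) → ℝ)} (hends : AreEnds P B T)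
    (hP : IsPolytope P) (hdim : HasDim P (n + 1)) {b c : ℝ}
    (hB : ∀ x ∈ B, x (Fin.last n) = b) (hT : ∀ x ∈ T, x (Fin.last n) = c) :
    IsLayered P B T b c := by
  obtain ⟨s, -, hPs⟩ := hP
  set V := {v | IsVertex P v} with hV
  have hVfin : V.Finite := s.finite_toSet.subset fun v hv => by
    rw [hV, hPs] at hv
    exact IsVertex.mem_of_convexHull hv
  have hPV : P = convexHull ℝ V := by
    rw [hV, hPs, convexHull_vertices s.finite_toSet]
  have hPconv : Convex ℝ P := hPV ▸ convex_convexHull ℝ V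
  have hBP : B ⊆ P := hends.isFace_left.subset
  have hTP : T ⊆ P := hends.isFace_right.subset
  -- A vertex is a nonempty face with a single point, so meeting an end means lying in it.
  have hVBT : V = V ∩ B ∪ V ∩ T := by
    rw [← Set.inter_union_distrib_left, eq_comm, Set.inter_eq_left]
    intro v hv
    rcases hends.meets {v} hv (Set.singleton_nonempty v) with ⟨x, rfl, hx⟩ | ⟨x, rfl, hx⟩
    · exact Or.inl hx
    · exact Or.inr hx
  have hcB : convexHull ℝ (V ∩ B) ⊆ B :=
    convexHull_min Set.inter_subset_right (hends.isFace_left.convex hPconv)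
  have hcT : convexHull ℝ (V ∩ T) ⊆ T :=
    convexHull_min Set.inter_subset_right (hends.isFace_right.convex hPconv)
  have hneB : (V ∩ B).Nonempty := by
    by_contra hne
    rw [Set.not_nonempty_iff_eq_empty] at hne
    rw [hne, Set.empty_union] at hVBT
    rw [← hVBT, ← hPV] at hcT
    exact hdim.not_level fun x hx => hT x (hcT hx)
  have hneT : (V ∩ T).Nonempty := by
    by_contra hne
    rw [Set.not_nonempty_iff_eq_empty] at hne
    rw [hne, Set.union_empty] at hVBT
    rw [← hVBT, ← hPV] at hcB
    exact hdim.not_level fun x hx => hB x (hcB hx)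
  have hex : ∀ x ∈ P, ∃ y ∈ convexHull ℝ (V ∩ B), ∃ z ∈ convexHull ℝ (V ∩ T),
      ∃ μ ∈ Set.Icc (0 : ℝ) 1, x = (1 - μ) • y + μ • z := by
    intro x hx
    rw [hPV, hVBT, convexHull_union hneB hneT, mem_convexJoin] at hx
    obtain ⟨y, hy, z, hz, hx⟩ := hx
    rw [segment_eq_image] at hx
    obtain ⟨μ, hμ, rfl⟩ := hx
    exact ⟨y, hy, z, hz, μ, hμ, rfl⟩
  have hlevel : ∀ (y z : Fin (n + 1) → ℝ) (μ : ℝ), y ∈ B → z ∈ T →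
      ((1 - μ) • y + μ • z) (Fin.last n) = b + μ * (c - b) := by
    intro y z μ hy hz
    simp [hB y hy, hT z hz]
    ring
  have hbc : b ≠ c := by
    rintro rfl
    refine hdim.not_level (i := Fin.last n) (b := b) fun x hx => ?_
    obtain ⟨y, hy, z, hz, μ, -, rfl⟩ := hex x hx
    rw [hlevel y z μ (hcB hy) (hcT hz)]
    ring
  -- The last coordinate determines `μ` because `b ≠ c`; at level `b` it is `0`.
  have hBeq : B = convexHull ℝ (V ∩ B) := by
    refine Set.Subset.antisymm (fun x hx => ?_) hcB
    obtain ⟨y, hy, z, hz, μ, -, rfl⟩ := hex x (hBP hx)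
    have h1 := hlevel y z μ (hcB hy) (hcT hz)
    rw [hB _ hx] at h1
    have : μ = 0 := by
      have : μ * (c - b) = 0 := by linarith
      exact (mul_eq_zero.1 this).resolve_right (sub_ne_zero.2 hbc.symm)
    simpa [this] using hy
  have hTeq : T = convexHull ℝ (V ∩ T) := by
    refine Set.Subset.antisymm (fun x hx => ?_) hcT
    obtain ⟨y, hy, z, hz, μ, -, rfl⟩ := hex x (hTP hx)
    have h1 := hlevel y z μ (hcB hy) (hcT hz)
    rw [hT _ hx] at h1
    have : μ = 1 := by
      have : (μ - 1) * (c - b) = 0 := by linarith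
      exact sub_eq_zero.1 ((mul_eq_zero.1 this).resolve_right (sub_ne_zero.2 hbc.symm))
    simpa [this] using hz
  refine ⟨?_, ?_, hB, hT, hbc, fun x => ⟨fun hx => ?_, ?_⟩⟩
  · rw [hBeq]
    exact .of_finite (hVfin.subset Set.inter_subset_left) hneB
  · rw [hTeq]
    exact .of_finite (hVfin.subset Set.inter_subset_left) hneT
  · obtain ⟨y, hy, z, hz, h⟩ := hex x hx
    exact ⟨y, hcB hy, z, hcT hz, h⟩
  · rintro ⟨y, hy, z, hz, μ, hμ, rfl⟩
    exact hPconv (hBP hy) (hTP hz) (sub_nonneg.2 hμ.2) hμ.1 (by ring)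

/-! ### Minkowski combinations of two polytopes -/

theorem IsPolytope.isCompact {d : ℕ} {P : Set (Fin d → ℝ)} (hP : IsPolytope P) : IsCompact P := by
  obtain ⟨s, -, rfl⟩ := hP
  exact s.finite_toSet.isCompact_convexHull ℝ

theorem IsPolytope.nonempty {d : ℕ} {P : Set (Fin d → ℝ)} (hP : IsPolytope P) : P.Nonempty := by
  obtain ⟨s, hs, rfl⟩ := hP
  exact (Finset.coe_nonempty.2 hs).convexHull

theorem IsPolytope.argmax_nonempty {d : ℕ} {P : Set (Fin d → ℝ)} (hP : IsPolytope P)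
    (u : Fin d → ℝ) : (argmax P u).Nonempty :=
  SmoothPrismatoid.argmax_nonempty hP.isCompact hP.nonempty u

section Blend

open scoped Pointwise

variable {d : ℕ} {B T : Set (Fin d → ℝ)} {α β : ℝ}

/-- A functional is maximized on a Minkowski sum by maximizing each summand separately; a summand
with weight zero imposes no condition. -/
theorem mem_argmax_blend (hα : 0 ≤ α) (hβ : 0 ≤ β) {y z : Fin d → ℝ} (hy : y ∈ B) (hz : z ∈ T)
    (w : Fin d → ℝ) : α • y + β • z ∈ argmax (α • B + β • T) w ↔
      (α = 0 ∨ y ∈ argmax B w) ∧ (β = 0 ∨ z ∈ argmax T w) := by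
  have hmem : ∀ y' ∈ B, ∀ z' ∈ T, α • y' + β • z' ∈ α • B + β • T := fun y' hy' z' hz' =>
    Set.add_mem_add (Set.smul_mem_smul_set hy') (Set.smul_mem_smul_set hz')
  constructor
  · rintro ⟨-, hm⟩
    refine ⟨or_iff_not_imp_left.2 fun h0 => ⟨hy, fun y' hy' => ?_⟩,
      or_iff_not_imp_left.2 fun h0 => ⟨hz, fun z' hz' => ?_⟩⟩
    · have := hm _ (hmem y' hy' z hz)
      simp only [dotProduct_add, dotProduct_smul, smul_eq_mul] at this
      exact le_of_mul_le_mul_left (by linarith) (hα.lt_of_ne (Ne.symm h0))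
    · have := hm _ (hmem y hy z' hz')
      simp only [dotProduct_add, dotProduct_smul, smul_eq_mul] at this
      exact le_of_mul_le_mul_left (by linarith) (hβ.lt_of_ne (Ne.symm h0))
  · rintro ⟨h1, h2⟩
    refine ⟨hmem y hy z hz, ?_⟩
    rintro _ ⟨_, ⟨y', hy', rfl⟩, _, ⟨z', hz', rfl⟩, rfl⟩
    simp only [dotProduct_add, dotProduct_smul, smul_eq_mul]
    refine add_le_add ?_ ?_
    · rcases h1 with rfl | h1
      · simp
      · exact mul_le_mul_of_nonneg_left (h1.2 y' hy') hα
    · rcases h2 with rfl | h2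
      · simp
      · exact mul_le_mul_of_nonneg_left (h2.2 z' hz') hβ

theorem IsPolytope.blend (hB : IsPolytope B) (hT : IsPolytope T) (α β : ℝ) :
    IsPolytope (α • B + β • T) := by
  classical
  obtain ⟨s, hs, rfl⟩ := hB
  obtain ⟨t, ht, rfl⟩ := hT
  refine ⟨α • s + β • t, hs.smul_finset.add ht.smul_finset, ?_⟩
  push_cast
  rw [convexHull_add, convexHull_smul, convexHull_smul]

theorem blend_minkowskiEquivalent (hB : IsPolytope B) (hT : IsPolytope T) (hα : 0 ≤ α)
    (hβ : 0 ≤ β) (hαβ : α + β = 1)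
    (h : ∀ u w, argmax B u ⊆ argmax B w ↔ argmax T u ⊆ argmax T w) :
    MinkowskiEquivalent (α • B + β • T) B := by
  refine minkowskiEquivalent_of_argmax (hB.blend hT α β).argmax_nonempty hB.argmax_nonempty
    fun u w => ⟨fun hS => ?_, fun hS => ?_⟩
  -- With `α = 0` the combination carries no information on `B`, and the comparison has to go
  -- through `T` by `h`.
  · by_cases h0 : α = 0
    · have h1 : β ≠ 0 := by
        rintro rfl
        simp [h0] at hαβ
      rw [h]
      intro z hz
      obtain ⟨y, hy⟩ := hB.argmax_nonempty u
      have := hS ((mem_argmax_blend hα hβ hy.1 hz.1 u).2 ⟨Or.inr hy, Or.inr hz⟩)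
      exact ((mem_argmax_blend hα hβ hy.1 hz.1 w).1 this).2.resolve_left h1
    · intro y hy
      obtain ⟨z, hz⟩ := hT.argmax_nonempty u
      have := hS ((mem_argmax_blend hα hβ hy.1 hz.1 u).2 ⟨Or.inr hy, Or.inr hz⟩)
      exact ((mem_argmax_blend hα hβ hy.1 hz.1 w).1 this).1.resolve_left h0
  · intro x hx
    obtain ⟨_, ⟨y, hy, rfl⟩, _, ⟨z, hz, rfl⟩, rfl⟩ := hx.1
    have h1 := (mem_argmax_blend hα hβ hy hz u).1 hx
    exact (mem_argmax_blend hα hβ hy hz w).2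
      ⟨h1.1.imp_right fun h2 => hS h2, h1.2.imp_right fun h2 => (h u w).1 hS h2⟩

theorem vectorSpan_le_blend (hT : T.Nonempty) (hα : α ≠ 0) :
    vectorSpan ℝ B ≤ vectorSpan ℝ (α • B + β • T) := by
  obtain ⟨z, hz⟩ := hT
  refine Submodule.span_le.2 ?_
  rintro _ ⟨y, hy, y', hy', rfl⟩
  have hmem : ∀ y ∈ B, α • y + β • z ∈ α • B + β • T := fun y hy =>
    Set.add_mem_add (Set.smul_mem_smul_set hy) (Set.smul_mem_smul_set hz)
  have := Submodule.smul_mem _ α⁻¹ (vsub_mem_vectorSpan ℝ (hmem y hy) (hmem y' hy'))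
  rwa [vsub_eq_sub, add_sub_add_right_eq_sub, ← smul_sub, inv_smul_smul₀ hα] at this

end Blend

/-! ### Slices, their normal fans and their dimension -/

open scoped Pointwise

variable {n : ℕ} {P B T : Set (Fin (n + 1) → ℝ)} {b c : ℝ}

theorem IsLayered.slice_eq (hL : IsLayered P B T b c) {μ : ℝ} (hμ : μ ∈ Set.Icc (0 : ℝ) 1) :
    P ∩ {x | x (Fin.last n) = b + μ * (c - b)} = (1 - μ) • B + μ • T := by
  have hlevel : ∀ (y z : Fin (n + 1) → ℝ) (μ : ℝ), y ∈ B → z ∈ T →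
      ((1 - μ) • y + μ • z) (Fin.last n) = b + μ * (c - b) := by
    intro y z μ hy hz
    simp [hL.level_left y hy, hL.level_right z hz]
    ring
  ext x
  constructor
  · rintro ⟨hx, hl⟩
    obtain ⟨y, hy, z, hz, ν, -, rfl⟩ := (hL.mem_iff x).1 hx
    have h1 := hlevel y z ν hy hz
    rw [Set.mem_ofPred_eq, h1] at hl
    have : ν = μ := mul_right_cancel₀ (sub_ne_zero.2 hL.ne.symm) (add_left_cancel hl)
    subst this
    exact Set.add_mem_add (Set.smul_mem_smul_set hy) (Set.smul_mem_smul_set hz)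
  · rintro ⟨_, ⟨y, hy, rfl⟩, _, ⟨z, hz, rfl⟩, rfl⟩
    exact ⟨(hL.mem_iff _).2 ⟨y, hy, z, hz, μ, hμ, rfl⟩, hlevel y z μ hy hz⟩

theorem IsLayered.left_subset (hL : IsLayered P B T b c) : B ⊆ P := fun y hy => by
  obtain ⟨z, hz⟩ := hL.right.nonempty
  exact (hL.mem_iff y).2 ⟨y, hy, z, hz, 0, by simp, by simp⟩

theorem IsLayered.right_subset (hL : IsLayered P B T b c) : T ⊆ P := fun z hz => by
  obtain ⟨y, hy⟩ := hL.left.nonempty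
  exact (hL.mem_iff z).2 ⟨y, hy, z, hz, 1, by simp, by simp⟩

theorem IsLayered.exists_argmax (hL : IsLayered P B T b c) (u : Fin (n + 1) → ℝ) :
    ∃ u', argmax P u' ∩ B = argmax B u ∧ argmax P u' ∩ T = argmax T u := by
  obtain ⟨y₀, hy₀⟩ := hL.left.argmax_nonempty u
  obtain ⟨z₀, hz₀⟩ := hL.right.argmax_nonempty u
  have hcb : c - b ≠ 0 := sub_ne_zero.2 hL.ne.symm
  -- The tilt that equalizes the maxima over the two ends: `u ⬝ᵥ y₀ + α * b = u ⬝ᵥ z₀ + α * c`.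
  set α : ℝ := (u ⬝ᵥ y₀ - u ⬝ᵥ z₀) / (c - b) with hα
  have hα' : α * c - α * b = u ⬝ᵥ y₀ - u ⬝ᵥ z₀ := by
    rw [← mul_sub, hα, div_mul_cancel₀ _ hcb]
  have htilt : ∀ x, (u + Pi.single (Fin.last n) α) ⬝ᵥ x = u ⬝ᵥ x + α * x (Fin.last n) := by
    intro x
    rw [add_dotProduct, single_dotProduct]
  have hvB : ∀ y ∈ B, (u + Pi.single (Fin.last n) α) ⬝ᵥ y = u ⬝ᵥ y + α * b := fun y hy => by
    rw [htilt, hL.level_left y hy]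
  have hvT : ∀ y ∈ T, (u + Pi.single (Fin.last n) α) ⬝ᵥ y = u ⬝ᵥ y + α * c := fun y hy => by
    rw [htilt, hL.level_right y hy]
  have hmax : ∀ x ∈ P, (u + Pi.single (Fin.last n) α) ⬝ᵥ x ≤ u ⬝ᵥ y₀ + α * b := by
    intro x hx
    obtain ⟨y, hy, z, hz, μ, hμ, rfl⟩ := (hL.mem_iff x).1 hx
    rw [dotProduct_add, dotProduct_smul, dotProduct_smul, hvB y hy, hvT z hz, smul_eq_mul,
      smul_eq_mul]
    have h1 := mul_le_mul_of_nonneg_left (hy₀.2 y hy) (sub_nonneg.2 hμ.2)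
    have h2 := mul_le_mul_of_nonneg_left (hz₀.2 z hz) hμ.1
    have h3 := congrArg (μ * ·) hα'
    rw [mul_sub, mul_sub] at h3
    linarith
  refine ⟨u + Pi.single (Fin.last n) α, ?_, ?_⟩
  · ext x
    constructor
    · rintro ⟨hx, hxB⟩
      refine ⟨hxB, fun y hy => ?_⟩
      have := hx.2 y (hL.left_subset hy)
      rw [hvB y hy, hvB x hxB] at this
      linarith
    · intro hx
      refine ⟨⟨hL.left_subset hx.1, fun y hy => (hmax y hy).trans ?_⟩, hx.1⟩
      rw [hvB x hx.1]
      linarith [hx.2 y₀ hy₀.1]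
  · ext x
    constructor
    · rintro ⟨hx, hxT⟩
      refine ⟨hxT, fun y hy => ?_⟩
      have := hx.2 y (hL.right_subset hy)
      rw [hvT y hy, hvT x hxT] at this
      linarith
    · intro hx
      refine ⟨⟨hL.right_subset hx.1, fun y hy => (hmax y hy).trans ?_⟩, hx.1⟩
      rw [hvT x hx.1]
      linarith [hx.2 z₀ hz₀.1]

theorem IsLayered.argmax_subset_iff (hL : IsLayered P B T b c) (hends : AreEnds P B T)
    (u w : Fin (n + 1) → ℝ) : argmax B u ⊆ argmax B w ↔ argmax T u ⊆ argmax T w := by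
  obtain ⟨u', hu1, hu2⟩ := hL.exists_argmax u
  obtain ⟨w', hw1, hw2⟩ := hL.exists_argmax w
  have := hends.subset_iff _ _ (isFace_argmax P u') (isFace_argmax P w')
    (hu1 ▸ hL.left.argmax_nonempty u) (hu2 ▸ hL.right.argmax_nonempty u)
    (hw1 ▸ hL.left.argmax_nonempty w) (hw2 ▸ hL.right.argmax_nonempty w)
  rw [hu1, hu2] at this
  rw [← hw1, ← hw2, Set.subset_inter_iff, Set.subset_inter_iff, this]
  exact ⟨fun h => ⟨h.1, fun x hx => hx.1⟩, fun h => ⟨h.1, fun x hx => hx.1⟩⟩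

/-- Since `B` and `T` are parallel, the direction space of `B` and one vector from `B` to `T` span
everything, so `B` has dimension at least `n`. The combination contains a translate of a nonzero
multiple of `B` or `T`, and lies in a hyperplane. -/
theorem IsLayered.hasDim_blend (hL : IsLayered P B T b c) (hdim : HasDim P (n + 1))
    (hpar : AreParallel B T) (μ : ℝ) :
    HasDim ((1 - μ) • B + μ • T) n := by
  obtain ⟨y₀, hy₀⟩ := hL.left.nonempty
  obtain ⟨z₀, hz₀⟩ := hL.right.nonempty
  have hne := (hL.left.blend hL.right (1 - μ) μ).nonempty
  have htop : ⊤ ≤ vectorSpan ℝ B ⊔ Submodule.span ℝ {z₀ - y₀} := by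
    rw [← hdim.vectorSpan_eq_top, vectorSpan_eq_span_vsub_set_right ℝ (hL.left_subset hy₀)]
    refine Submodule.span_le.2 ?_
    rintro _ ⟨x, hx, rfl⟩
    obtain ⟨y, hy, z, hz, ν, -, rfl⟩ := (hL.mem_iff x).1 hx
    have h1 : y - y₀ ∈ vectorSpan ℝ B := vsub_mem_vectorSpan ℝ hy hy₀
    have h2 : z - z₀ ∈ vectorSpan ℝ B := by
      rw [show vectorSpan ℝ B = vectorSpan ℝ T from hpar]
      exact vsub_mem_vectorSpan ℝ hz hz₀
    refine Submodule.mem_sup.2 ⟨(1 - ν) • (y - y₀) + ν • (z - z₀),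
      add_mem (Submodule.smul_mem _ _ h1) (Submodule.smul_mem _ _ h2), ν • (z₀ - y₀),
      Submodule.smul_mem _ _ (Submodule.mem_span_singleton_self _), ?_⟩
    simp only [vsub_eq_sub]
    module
  have hge : n ≤ Module.finrank ℝ (vectorSpan ℝ B) := by
    have h1 := Submodule.finrank_mono htop
    have h2 := Submodule.finrank_add_le_finrank_add_finrank (vectorSpan ℝ B)
      (Submodule.span ℝ {z₀ - y₀})
    have h3 : Module.finrank ℝ (Submodule.span ℝ {z₀ - y₀}) ≤ 1 :=
      (finrank_span_le_card _).trans (by simp)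
    rw [finrank_top, Module.finrank_fin_fun] at h1
    omega
  have hle : vectorSpan ℝ B ≤ vectorSpan ℝ ((1 - μ) • B + μ • T) := by
    by_cases h0 : 1 - μ = 0
    · rw [show vectorSpan ℝ B = vectorSpan ℝ T from hpar, add_comm (_ • B)]
      exact vectorSpan_le_blend hL.left.nonempty (by linarith : μ ≠ 0)
    · exact vectorSpan_le_blend hL.right.nonempty h0
  have hup : vectorSpan ℝ ((1 - μ) • B + μ • T) < ⊤ := by
    refine lt_of_le_of_lt (vectorSpan_le_ker_proj (i := Fin.last n) (b := b + μ * (c - b)) ?_)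
      (ker_proj_lt_top (Fin.last n))
    rintro _ ⟨_, ⟨y, hy, rfl⟩, _, ⟨z, hz, rfl⟩, rfl⟩
    simp [hL.level_left y hy, hL.level_right z hz]
    ring
  have h1 := Submodule.finrank_mono hle
  have h2 := Submodule.finrank_lt hup.ne
  rw [Module.finrank_fin_fun] at h2
  exact ⟨hne, by omega⟩

/-! ### Edges between the ends and integrality of the slices -/

theorem IsLayered.meets_right (hL : IsLayered P B T b c) {F : Set (Fin (n + 1) → ℝ)}
    (hF : IsFace P F) {x : Fin (n + 1) → ℝ} (hx : x ∈ F) (hxb : x (Fin.last n) ≠ b) :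
    (F ∩ T).Nonempty := by
  obtain ⟨e, rfl⟩ := hF.exists_eq_argmax ⟨x, hx⟩
  obtain ⟨y, hy, z, hz, μ, hμ, rfl⟩ := (hL.mem_iff x).1 hx.1
  have hμ0 : 0 < μ := by
    refine hμ.1.lt_of_ne ?_
    rintro rfl
    exact hxb (by simp [hL.level_left y hy])
  have h1 := hx.2 y (hL.left_subset hy)
  refine ⟨z, ⟨hL.right_subset hz, fun p hp => (hx.2 p hp).trans ?_⟩, hz⟩
  simp only [dotProduct_add, dotProduct_smul, smul_eq_mul] at h1 ⊢
  have h2 : μ * (e ⬝ᵥ y) ≤ μ * (e ⬝ᵥ z) := by linarith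
  have h3 := le_of_mul_le_mul_left h2 hμ0
  nlinarith [mul_nonneg (sub_nonneg.2 hμ.2) (sub_nonneg.2 h3)]

/-- An edge leaving the level of `B` at `v` also meets `T`. Comparing it with the face that meets
the ends in `{v}` and `{w}` shows that it contains `w`, so it lies on the line through `v` and `w`.
-/
theorem IsLayered.exists_smul_of_mem_primitiveEdgeDirections (hL : IsLayered P B T b c)
    (hends : AreEnds P B T) {a v w : Fin (n + 1) → ℝ} (hv : argmax B a = {v})
    (hw : argmax T a = {w}) {u : Fin (n + 1) → ℤ} (hu : u ∈ primitiveEdgeDirections P v)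
    (hu0 : u (Fin.last n) ≠ 0) : ∃ r : ℝ, latticePoint u = r • (w - v) := by
  obtain ⟨-, F, ⟨hF, hF1⟩, hvF, t, ht, htF⟩ := hu
  have hvB : v ∈ B := (hv.symm ▸ rfl : v ∈ argmax B a).1
  have hwT : w ∈ T := (hw.symm ▸ rfl : w ∈ argmax T a).1
  have hwF : w ∈ F := by
    obtain ⟨a', ha1, ha2⟩ := hL.exists_argmax a
    rw [hv] at ha1
    rw [hw] at ha2
    have hFT : (F ∩ T).Nonempty := by
      refine hL.meets_right hF htF ?_
      simp [hL.level_left v hvB, latticePoint, ht.ne', hu0]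
    have := (hends.subset_iff _ F (isFace_argmax P a') hF (ha1 ▸ Set.singleton_nonempty v)
      (ha2 ▸ Set.singleton_nonempty w) ⟨v, hvF, hvB⟩ hFT).1
      (by rw [ha1]; exact Set.singleton_subset_iff.2 hvF)
    rw [ha2] at this
    exact this rfl
  have h1 : w - v ∈ vectorSpan ℝ F := vsub_mem_vectorSpan ℝ hwF hvF
  have h2 : t • latticePoint u ∈ vectorSpan ℝ F := by
    simpa using vsub_mem_vectorSpan ℝ htF hvF
  have hne : (⟨w - v, h1⟩ : vectorSpan ℝ F) ≠ 0 := by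
    intro h
    have h3 : w = v := sub_eq_zero.1 (congrArg Subtype.val h)
    exact hL.ne (by rw [← hL.level_left v hvB, ← h3, hL.level_right w hwT])
  obtain ⟨r, hr⟩ := (finrank_eq_one_iff_of_nonzero' _ hne).1 hF1.2 ⟨_, h2⟩
  have hr' : r • (w - v) = t • latticePoint u := congrArg Subtype.val hr
  exact ⟨t⁻¹ * r, by rw [mul_smul, hr', inv_smul_smul₀ ht.ne']⟩

/-- Basis vectors with nonzero `i`-th coordinate are all proportional to `δ`, so by independence
there is only one. As the basis generates a vector with `i`-th coordinate `1`, that coordinate of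
`u` is `±1`, and `δ` is an integer multiple of `u`. -/
theorem IsLatticeBasis.exists_eq_smul {d : ℕ} {D : Set (Fin d → ℤ)} (hD : IsLatticeBasis D)
    {i : Fin d} {δ : Fin d → ℤ} (hδ : δ i ≠ 0)
    (h : ∀ u ∈ D, u i ≠ 0 → ∃ r : ℝ, latticePoint u = r • latticePoint δ) :
    ∃ z : Fin d → ℤ, δ = δ i • z := by
  have hcross : ∀ u ∈ D, u i ≠ 0 → ∀ j, u j * δ i = u i * δ j := by
    intro u hu hu0 j
    obtain ⟨r, hr⟩ := h u hu hu0
    have h1 : ∀ k, (u k : ℝ) = r * δ k := fun k => congrFun hr k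
    have : ((u j * δ i : ℤ) : ℝ) = ((u i * δ j : ℤ) : ℝ) := by
      push_cast
      rw [h1 j, h1 i]
      ring
    exact_mod_cast this
  have huniq : ∀ u ∈ D, u i ≠ 0 → ∀ u' ∈ D, u' i ≠ 0 → u = u' := by
    intro u hu hu0 u' hu' hu0'
    by_contra hne
    have hinj : Function.Injective ![(⟨u, hu⟩ : D), ⟨u', hu'⟩] := by
      intro k l hkl
      fin_cases k <;> fin_cases l <;> simp_all [eq_comm]
    have hli := hD.1.comp _ hinj
    have hpair : LinearIndependent ℤ ![u, u'] := by
      convert hli using 1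
      funext k
      fin_cases k <;> rfl
    -- Proportionality to `δ` gives the integer relation `u' i • u - u i • u' = 0`.
    refine hu0' (LinearIndependent.pair_iff.1 hpair (u' i) (-u i) ?_).1
    funext j
    have e1 := hcross u hu hu0 j
    have e2 := hcross u' hu' hu0' j
    refine mul_right_cancel₀ hδ ?_
    simp only [Pi.add_apply, Pi.smul_apply, smul_eq_mul, Pi.zero_apply, zero_mul, add_mul,
      mul_assoc, e1, e2]
    ring
  have hex : ∃ u ∈ D, u i ≠ 0 := by
    by_contra! hall
    have hle : Submodule.span ℤ D ≤
        LinearMap.ker (LinearMap.proj (R := ℤ) (φ := fun _ : Fin d => ℤ) i) :=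
      Submodule.span_le.2 fun u hu => hall u hu
    rw [hD.2] at hle
    have : (Pi.single i 1 : Fin d → ℤ) i = 0 :=
      hle (Submodule.mem_top (x := (Pi.single i 1 : Fin d → ℤ)))
    simp at this
  obtain ⟨u, hu, hu0⟩ := hex
  have hle : Submodule.span ℤ D ≤ Submodule.comap
      (LinearMap.proj (R := ℤ) (φ := fun _ : Fin d => ℤ) i) (Ideal.span {u i}) := by
    refine Submodule.span_le.2 fun u' hu' => ?_
    by_cases h0 : u' i = 0
    · simp [h0]
    · rw [← huniq u hu hu0 u' hu' h0]
      exact Ideal.mem_span_singleton_self (u i)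
  rw [hD.2] at hle
  have h1 : (Pi.single i 1 : Fin d → ℤ) i ∈ Ideal.span {u i} :=
    hle (Submodule.mem_top (x := (Pi.single i 1 : Fin d → ℤ)))
  rw [Pi.single_eq_same, Ideal.mem_span_singleton] at h1
  have hsq : u i * u i = 1 := Int.isUnit_mul_self (isUnit_of_dvd_one h1)
  -- The factor `u i = ±1` orients `u` so that its `i`-th coordinate is `1`.
  refine ⟨u i • u, ?_⟩
  funext j
  have := hcross u hu hu0 j
  simp only [Pi.smul_apply, smul_eq_mul]
  calc δ j = u i * (u i * δ j) := by rw [← mul_assoc, hsq, one_mul]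
    _ = δ i * (u i * u j) := by rw [← this]; ring

theorem argmax_eq_singleton_of_blend {d : ℕ} {B T : Set (Fin d → ℝ)} {α β : ℝ}
    (hB : IsPolytope B) (hT : IsPolytope T) (hα : 0 < α) (hβ : 0 < β) {p a : Fin d → ℝ}
    (hp : argmax (α • B + β • T) a = {p}) :
    ∃ v w, argmax B a = {v} ∧ argmax T a = {w} ∧ p = α • v + β • w := by
  have hmem : ∀ y ∈ argmax B a, ∀ z ∈ argmax T a, α • y + β • z = p := by
    intro y hy z hz
    have := (mem_argmax_blend hα.le hβ.le hy.1 hz.1 a).2 ⟨Or.inr hy, Or.inr hz⟩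
    rwa [hp] at this
  obtain ⟨v, hv⟩ := hB.argmax_nonempty a
  obtain ⟨w, hw⟩ := hT.argmax_nonempty a
  refine ⟨v, w, Set.eq_singleton_iff_unique_mem.2 ⟨hv, fun y hy => ?_⟩,
    Set.eq_singleton_iff_unique_mem.2 ⟨hw, fun z hz => ?_⟩, (hmem v hv w hw).symm⟩
  · have := (hmem y hy w hw).trans (hmem v hv w hw).symm
    exact smul_right_injective _ hα.ne' (add_right_cancel this)
  · have := (hmem v hv z hz).trans (hmem v hv w hw).symm
    exact smul_right_injective _ hβ.ne' (add_left_cancel this)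

theorem IsLatticePolytope.mem_range_of_isVertex {d : ℕ} {P : Set (Fin d → ℝ)}
    (hP : IsLatticePolytope P) {v : Fin d → ℝ} (hv : IsVertex P v) :
    ∃ z : Fin d → ℤ, latticePoint z = v := by
  obtain ⟨s, -, rfl⟩ := hP
  obtain ⟨z, -, hz⟩ := hv.mem_of_convexHull
  exact ⟨z, hz⟩

theorem IsVertex.exists_argmax {d : ℕ} {A : Set (Fin d → ℝ)} {v : Fin d → ℝ}
    (hv : IsVertex A v) : ∃ a, argmax A a = {v} := by
  obtain ⟨a, ha⟩ := IsFace.exists_eq_argmax hv (Set.singleton_nonempty v)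
  exact ⟨a, ha.symm⟩

theorem IsLayered.isVertex_of_argmax_left (hL : IsLayered P B T b c) (hB : IsFace P B)
    {a v : Fin (n + 1) → ℝ} (ha : argmax B a = {v}) : IsVertex P v := by
  obtain ⟨a', h1, -⟩ := hL.exists_argmax a
  rw [IsVertex, ← ha, ← h1]
  exact IsExposed.inter (isFace_argmax P a') hB

theorem IsLayered.isVertex_of_argmax_right (hL : IsLayered P B T b c) (hT : IsFace P T)
    {a v : Fin (n + 1) → ℝ} (ha : argmax T a = {v}) : IsVertex P v := by
  obtain ⟨a', -, h1⟩ := hL.exists_argmax a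
  rw [IsVertex, ← ha, ← h1]
  exact IsExposed.inter (isFace_argmax P a') hT

theorem IsLayered.isLatticePolytope_blend {b : ℤ} {h : ℕ}
    (hL : IsLayered P B T (b : ℝ) ((b + h : ℤ) : ℝ)) (hends : AreEnds P B T)
    (hsmooth : IsSmoothPolytope P) {l : ℕ} (hl : l ≤ h) :
    IsLatticePolytope ((1 - (l / h : ℝ)) • B + (l / h : ℝ) • T) := by
  have hh : (h : ℝ) ≠ 0 := fun h0 => hL.ne (by push_cast; rw [h0, add_zero])
  obtain ⟨s, hs, hS⟩ := hL.left.blend hL.right (1 - (l / h : ℝ)) (l / h : ℝ)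
  rw [hS]
  refine .of_vertices s.finite_toSet (by simpa using hs) fun p hp => ?_
  rw [← hS] at hp
  -- The end slices are `B` and `T` themselves, whose vertices are vertices of `P`. They are treated
  -- apart because splitting a vertex into `v` and `w` needs both weights positive.
  rcases Nat.eq_zero_or_pos l with rfl | hl0
  · have hB : (1 - ((0 : ℕ) / h : ℝ)) • B + ((0 : ℕ) / h : ℝ) • T = B := by
      simp [Set.zero_smul_set hL.right.nonempty]
    rw [hB] at hp
    obtain ⟨a, ha⟩ := hp.exists_argmax
    exact hsmooth.1.mem_range_of_isVertex (hL.isVertex_of_argmax_left hends.isFace_left ha)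
  rcases hl.eq_or_lt with rfl | hlt
  · have hT : (1 - (l / l : ℝ)) • B + (l / l : ℝ) • T = T := by
      rw [div_self hh]
      simp [Set.zero_smul_set hL.left.nonempty]
    rw [hT] at hp
    obtain ⟨a, ha⟩ := hp.exists_argmax
    exact hsmooth.1.mem_range_of_isVertex (hL.isVertex_of_argmax_right hends.isFace_right ha)
  have hl0' : (0 : ℝ) < l := by exact_mod_cast hl0
  have hlt' : (l : ℝ) < h := by exact_mod_cast hlt
  obtain ⟨a, ha⟩ := hp.exists_argmax
  obtain ⟨v, w, hv, hw, rfl⟩ := argmax_eq_singleton_of_blend hL.left hL.right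
    (sub_pos.2 ((div_lt_one (hl0'.trans hlt')).2 hlt')) (div_pos hl0' (hl0'.trans hlt')) ha
  have hvP := hL.isVertex_of_argmax_left hends.isFace_left hv
  have hvB : v ∈ B := (hv.symm ▸ rfl : v ∈ argmax B a).1
  have hwT : w ∈ T := (hw.symm ▸ rfl : w ∈ argmax T a).1
  obtain ⟨v', rfl⟩ := hsmooth.1.mem_range_of_isVertex hvP
  obtain ⟨w', rfl⟩ := hsmooth.1.mem_range_of_isVertex
    (hL.isVertex_of_argmax_right hends.isFace_right hw)
  have hsub : latticePoint w' - latticePoint v' = latticePoint (w' - v') := by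
    funext i
    simp [latticePoint]
  have hlast : (w' - v') (Fin.last n) = h := by
    have h1 : v' (Fin.last n) = b := Int.cast_injective (hL.level_left _ hvB)
    have h2 : w' (Fin.last n) = b + h := Int.cast_injective (hL.level_right _ hwT)
    rw [Pi.sub_apply, h1, h2]
    ring
  obtain ⟨z, hz⟩ := (hsmooth.2.2 _ hvP).exists_eq_smul (i := Fin.last n) (δ := w' - v')
    (by rw [hlast]; exact_mod_cast hh) fun u hu hu0 => by
      rw [← hsub]
      exact hL.exists_smul_of_mem_primitiveEdgeDirections hends hv hw hu hu0
  rw [hlast] at hz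
  -- With `w' - v' = h • z`, the point `(1 - l/h) • v' + (l/h) • w'` equals `v' + l • z`.
  refine ⟨v' + (l : ℤ) • z, ?_⟩
  funext i
  have hi : ((w' i - v' i : ℤ) : ℝ) = ((h * z i : ℤ) : ℝ) := congrArg _ (congrFun hz i)
  push_cast at hi
  simp only [latticePoint, Pi.add_apply, Pi.smul_apply, smul_eq_mul]
  push_cast
  rw [eq_add_of_sub_eq hi]
  field_simp
  ring

end SmoothPrismatoid

/-! ### The lemma on slices of smooth prismatoids -/

open scoped Pointwise

theorem mainTheorem7 (n : ℕ) (P B T : Set (Fin (n + 1) → ℝ))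
    (hprismatoid : SmoothPrismatoid.IsPrismatoid P B T)
    (hsmooth : SmoothPrismatoid.IsSmoothPolytope P)
    (b : ℤ) (h : ℕ)
    (hB : B ⊆ {x | x (Fin.last n) = (b : ℝ)})
    (hT : T ⊆ {x | x (Fin.last n) = ((b + h : ℤ) : ℝ)}) :
    ∀ l : ℕ, l ≤ h →
      SmoothPrismatoid.IsLatticePolytope (SmoothPrismatoid.sliceAt P (b + l)) ∧
      SmoothPrismatoid.HasDim (SmoothPrismatoid.sliceAt P (b + l)) n ∧
      SmoothPrismatoid.MinkowskiEquivalent (SmoothPrismatoid.sliceAt P (b + l)) B ∧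
      SmoothPrismatoid.MinkowskiEquivalent (SmoothPrismatoid.sliceAt P (b + l)) T := by
  intro l hl
  have hends := hprismatoid.areEnds
  have hL := hends.isLayered hprismatoid.1 hprismatoid.2.1 hB hT
  -- Full dimension forces the two levels to differ, so `h` is positive and `l / h` is the true
  -- relative height.
  have hh : (h : ℝ) ≠ 0 := fun h0 => hL.ne (by push_cast; rw [h0, add_zero])
  have hμ : (l / h : ℝ) ∈ Set.Icc (0 : ℝ) 1 :=
    ⟨by positivity, div_le_one_of_le₀ (by exact_mod_cast hl) (by positivity)⟩
  have hslice : SmoothPrismatoid.sliceAt P (b + l) =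
      (1 - (l / h : ℝ)) • B + (l / h : ℝ) • T := by
    rw [← hL.slice_eq hμ, SmoothPrismatoid.sliceAt]
    congr! 4
    push_cast
    field_simp
    ring
  have hBT := hL.argmax_subset_iff hends
  rw [hslice]
  refine ⟨hL.isLatticePolytope_blend hends hsmooth hl,
    hL.hasDim_blend hprismatoid.2.1 hprismatoid.2.2.1 _,
    SmoothPrismatoid.blend_minkowskiEquivalent hL.left hL.right (sub_nonneg.2 hμ.2) hμ.1
      (by ring) hBT, ?_⟩
  -- The comparison with `T` is the one with `B` after exchanging the two ends.
  rw [add_comm (_ • B)]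
  exact SmoothPrismatoid.blend_minkowskiEquivalent hL.right hL.left hμ.1 (sub_nonneg.2 hμ.2)
    (by ring) fun u w => (hBT u w).symm
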